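/- **Minimum principle of the specific entropy.** Let $d$ be the space dimension, $\epsilon,\mu,T>0$, and let $s=s(\rho,e):(0,\infty)\times(0,\infty)\to\mathbb{R}$ be a specific entropy of class $C^2$ such that $s_e:=\partial s/\partial e>0$ and such that $-s$ is strictly convex as a function of $(v,e)$, where $v=1/\rho$ is the specific volume. Let the pressure be given by Gibbs' identity $\mathrm{d}s=\frac1\theta\,\mathrm{d}e+\frac p\theta\,\mathrm{d}v$, that is, $p(\rho,e)=-\rho^2 s_\rho/s_e$ with $s_\rho:=\partial s/\partial\rho$. Let $\rho$ (density), $\mathbf m$ (momentum, $\mathbb{R}^d$-valued), $E$ (total energy) and $\mathbf B$ (magnetic field, $\mathbb{R}^d$-valued) be functions of class $C^2$ on $\mathbb{R}^d\times[0,T]$ with $\rho>0$ and $e>0$ everywhere, where $$e=\rho^{-1}\Big(E-\tfrac{1}{2\rho}|\mathbf m|^2-\tfrac1{2\mu}|\mathbf B|^2\Big)$$ is the specific internal energy, and with $\operatorname{div}\mathbf B(\cdot,0)=0$. Suppose that on $\mathbb{R}^d\times(0,T)$ they satisfy the viscous regularization of the MHD system with no viscosity in the induction equation, $$\begin{aligned}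 \partial_t\rho+\operatorname{div}\mathbf m&=\epsilon\Delta\rho,\\ \partial_t\mathbf m+\operatorname{div}\!\Big(\rho^{-1}\mathbf m\mathbf m^\top-\mu^{-1}\mathbf B\mathbf B^\top+\mathbb I\big(p+\tfrac1{2\mu}|\mathbf B|^2\big)\Big)&=\epsilon\Delta\mathbf m,\\ \partial_t E+\operatorname{div}\!\Big(\tfrac{\mathbf m}{\rho}\big(E+p+\tfrac1{2\mu}|\mathbf B|^2\big)-\mu^{-1}\mathbf B\big(\mathbf B^\top\tfrac{\mathbf m}{\rho}\big)\Big)&=\epsilon\Delta\Big(E-\tfrac1{2\mu}|\mathbf B|^2\Big),\\ \partial_t\mathbf B+\operatorname{div}\!\big(\rho^{-1}\mathbf m\mathbf B^\top-\rho^{-1}\mathbf B\mathbf m^\top\big)&=\mathbf 0, \end{aligned}$$ where $p=p(\rho,e)$ and the divergence of a tensor field is $(\operatorname{div}A)_j=\sum_i\partial_iA_{ij}$. Suppose moreover that there are constants $\rho_\infty>0$ and $e_\infty>0$ such that $\rho(x,t)\to\rho_\infty$ and $e(x,t)\to e_\infty$ as $|x|\to\infty$, uniformly in $t\in[0,T]$.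 Then, for every $t\in[0,T]$, $$\inf_{x\in\mathbb{R}^d}s(\rho(x,t),e(x,t))\ \ge\ \inf_{x\in\mathbb{R}^d}s(\rho(x,0),e(x,0)).$$ -/

import Mathlib

open Set Filter

noncomputable section

namespace MHD

/-- Physical space `ℝ^d` with its Euclidean structure. -/
abbrev Space (d : ℕ) := EuclideanSpace ℝ (Fin d)

/-! ### Differential operators in space -/

/-- The partial derivative `∂_i f (x)`. -/
def partialDeriv {d : ℕ} (i : Fin d) (f : Space d → ℝ) (x : Space d) : ℝ :=
  fderiv ℝ f x (EuclideanSpace.single i 1)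

/-- The divergence `∑ i, ∂_i F_i` of a vector field. -/
def divergence {d : ℕ} (F : Space d → Space d) (x : Space d) : ℝ :=
  ∑ i, partialDeriv i (fun y => F y i) x

/-- The divergence of a tensor field, `(div A)_j = ∑ i, ∂_i A_ij`. -/
def tensorDivergence {d : ℕ} (A : Space d → Matrix (Fin d) (Fin d) ℝ) (x : Space d) : Space d :=
  WithLp.toLp 2 fun j => ∑ i, partialDeriv i (fun y => A y i j) x

/-- The tensor `a bᵀ`. -/
def outer {d : ℕ} (a b : Space d) : Matrix (Fin d) (Fin d) ℝ :=
  Matrix.of fun i j => a i * b j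

/-! ### Thermodynamics -/

/-- The open quadrant of positive pairs, on which the entropy is defined. -/
def positiveQuadrant : Set (ℝ × ℝ) := Ioi 0 ×ˢ Ioi 0

/-- `∂s/∂ρ` for a specific entropy `s = s(ρ, e)`. -/
def entropyRho (s : ℝ → ℝ → ℝ) (ρ e : ℝ) : ℝ := deriv (fun r => s r e) ρ

/-- `∂s/∂e` for a specific entropy `s = s(ρ, e)`. -/
def entropyE (s : ℝ → ℝ → ℝ) (ρ e : ℝ) : ℝ := deriv (fun a => s ρ a) e

/-- The pressure determined by `s` through the Gibbs identity
`ds = (1/θ) de + (p/θ) d(1/ρ)`, that is `s_e = 1/θ` and `s_ρ = -p/(θ ρ²)`. -/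
def pressure (s : ℝ → ℝ → ℝ) (ρ e : ℝ) : ℝ :=
  -(ρ ^ 2 * entropyRho s ρ e / entropyE s ρ e)

/-- Physical restrictions on a specific entropy `s(ρ, e)`, `ρ, e > 0`: it is twice continuously
differentiable, the temperature is positive, and `-s` is strictly convex as a function of the
specific volume `v = 1/ρ` and of `e`. -/
structure IsAdmissibleEntropy (s : ℝ → ℝ → ℝ) : Prop where
  smooth : ContDiffOn ℝ 2 (fun q : ℝ × ℝ => s q.1 q.2) positiveQuadrant
  temperature_pos : ∀ ρ e : ℝ, 0 < ρ → 0 < e → 0 < entropyE s ρ e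
  strictConvex : StrictConvexOn ℝ positiveQuadrant (fun q : ℝ × ℝ => -s q.1⁻¹ q.2)

/-! ### The magnetohydrodynamic state and the regularized system -/

/-- Space-time fields: density, momentum, total energy and magnetic field, as functions of time
and position. -/
structure Flow (d : ℕ) where
  rho : ℝ → Space d → ℝ
  mom : ℝ → Space d → Space d
  energy : ℝ → Space d → ℝ
  mag : ℝ → Space d → Space d

namespace Flow

variable {d : ℕ}

/-- The velocity `m / ρ`. -/
def velocity (u : Flow d) (t : ℝ) (x : Space d) : Space d :=
  (u.rho t x)⁻¹ • u.mom t x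

/-- The magnetic energy density (magnetic pressure) `|B|² / (2μ)`. -/
def magneticEnergy (μ : ℝ) (u : Flow d) (t : ℝ) (x : Space d) : ℝ :=
  ‖u.mag t x‖ ^ 2 / (2 * μ)

/-- The specific internal energy `e = ρ⁻¹ (E - |m|²/(2ρ) - |B|²/(2μ))`. -/
def specificInternalEnergy (μ : ℝ) (u : Flow d) (t : ℝ) (x : Space d) : ℝ :=
  (u.rho t x)⁻¹ *
    (u.energy t x - ‖u.mom t x‖ ^ 2 / (2 * u.rho t x) - u.magneticEnergy μ t x)

/-- The specific entropy field `s(ρ(x,t), e(x,t))`. -/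
def specificEntropy (s : ℝ → ℝ → ℝ) (μ : ℝ) (u : Flow d) (t : ℝ) (x : Space d) : ℝ :=
  s (u.rho t x) (u.specificInternalEnergy μ t x)

/-- The pressure field `p(ρ(x,t), e(x,t))`. -/
def pressureField (s : ℝ → ℝ → ℝ) (μ : ℝ) (u : Flow d) (t : ℝ) (x : Space d) : ℝ :=
  pressure s (u.rho t x) (u.specificInternalEnergy μ t x)

/-- The momentum flux `ρ⁻¹ m mᵀ - μ⁻¹ B Bᵀ + (p + |B|²/(2μ)) I`. -/
def momentumFlux (s : ℝ → ℝ → ℝ) (μ : ℝ) (u : Flow d) (t : ℝ) (x : Space d) :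
    Matrix (Fin d) (Fin d) ℝ :=
  (u.rho t x)⁻¹ • outer (u.mom t x) (u.mom t x) - μ⁻¹ • outer (u.mag t x) (u.mag t x)
    + (u.pressureField s μ t x + u.magneticEnergy μ t x) • (1 : Matrix (Fin d) (Fin d) ℝ)

/-- The energy flux `(E + p + |B|²/(2μ)) m/ρ - μ⁻¹ (B · m/ρ) B`. -/
def energyFlux (s : ℝ → ℝ → ℝ) (μ : ℝ) (u : Flow d) (t : ℝ) (x : Space d) : Space d :=
  (u.energy t x + u.pressureField s μ t x + u.magneticEnergy μ t x) • u.velocity t x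
    - (μ⁻¹ * inner ℝ (u.mag t x) (u.velocity t x)) • u.mag t x

/-- The flux `ρ⁻¹ m Bᵀ - ρ⁻¹ B mᵀ` of the induction equation. -/
def inductionFlux (u : Flow d) (t : ℝ) (x : Space d) : Matrix (Fin d) (Fin d) ℝ :=
  (u.rho t x)⁻¹ • outer (u.mom t x) (u.mag t x) - (u.rho t x)⁻¹ • outer (u.mag t x) (u.mom t x)

/-- `u` is a smooth (`C²` on `[0,T] × ℝ^d`), pointwise admissible (`ρ > 0`, `e > 0`) solution on
`[0,T] × ℝ^d` of the viscous regularization of the MHD system in divergence form, with viscosity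
`ε`, magnetic permeability `μ`, equation of state `s`, no viscosity in the induction equation,
and divergence-free initial magnetic field. -/
structure IsSmoothSolution (s : ℝ → ℝ → ℝ) (ε μ T : ℝ) (u : Flow d) : Prop where
  smooth_rho : ContDiffOn ℝ 2 (fun q : ℝ × Space d => u.rho q.1 q.2) (Icc 0 T ×ˢ univ)
  smooth_mom : ContDiffOn ℝ 2 (fun q : ℝ × Space d => u.mom q.1 q.2) (Icc 0 T ×ˢ univ)
  smooth_energy : ContDiffOn ℝ 2 (fun q : ℝ × Space d => u.energy q.1 q.2) (Icc 0 T ×ˢ univ)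
  smooth_mag : ContDiffOn ℝ 2 (fun q : ℝ × Space d => u.mag q.1 q.2) (Icc 0 T ×ˢ univ)
  rho_pos : ∀ t ∈ Icc 0 T, ∀ x, 0 < u.rho t x
  internalEnergy_pos : ∀ t ∈ Icc 0 T, ∀ x, 0 < u.specificInternalEnergy μ t x
  initial_mag : ∀ x, divergence (u.mag 0) x = 0
  mass : ∀ t ∈ Ioo 0 T, ∀ x,
    deriv (fun τ => u.rho τ x) t + divergence (u.mom t) x = ε * Laplacian.laplacian (u.rho t) x
  momentum : ∀ t ∈ Ioo 0 T, ∀ x,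
    deriv (fun τ => u.mom τ x) t + tensorDivergence (u.momentumFlux s μ t) x
      = ε • Laplacian.laplacian (u.mom t) x
  totalEnergy : ∀ t ∈ Ioo 0 T, ∀ x,
    deriv (fun τ => u.energy τ x) t + divergence (u.energyFlux s μ t) x
      = ε * Laplacian.laplacian (fun y => u.energy t y - u.magneticEnergy μ t y) x
  induction : ∀ t ∈ Ioo 0 T, ∀ x,
    deriv (fun τ => u.mag τ x) t + tensorDivergence (u.inductionFlux t) x = 0

/-- The density and the specific internal energy converge, as `|x| → ∞` and uniformly for
`t ∈ [0,T]`, to constants `ρ∞ > 0` and `e∞ > 0`. -/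
def ConvergesToConstantState (μ T : ℝ) (u : Flow d) : Prop :=
  ∃ ρinf einf : ℝ, 0 < ρinf ∧ 0 < einf ∧
    TendstoUniformlyOn (fun x t => u.rho t x) (fun _ => ρinf)
      (cocompact (Space d)) (Icc 0 T) ∧
    TendstoUniformlyOn (fun x t => u.specificInternalEnergy μ t x) (fun _ => einf)
      (cocompact (Space d)) (Icc 0 T)

end Flow

end MHD

end

/-! The proof is a comparison at a touching point, and never differentiates the entropy twice along
the flow. Suppose `s + η t`, with `η > 0`, attains at an interior `(t₀, x₀)` its minimum over all of
space and all times in `[0, t₀]`. Let `w`, `p₀`, `b = s_e` be the velocity, pressure and inverse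
temperature there. Concavity of `s` in `(1/ρ, e)`, multiplied by `ρ`, and convexity of `|m|²/(2ρ)`
give `ρ (s - s(t₀, x₀)) ≤ b H` with `H = E - |B|²/(2μ) - w·m + κ ρ + p₀`, which vanishes at `(t₀,
x₀)` (`entropy_sub_le_touching`, `touching_self`). So `H(t₀, ·)` is minimal at `x₀`, where `∇H = 0`
and `ΔH ≥ 0`.

Viscosity acts exactly on `ρ`, `m` and `E - |B|²/(2μ)`, in which `H` is affine, so `∂ₜH` is `ε ΔH`
minus a combination of fluxes (`hasDerivAt_touching`). That combination vanishes where `∇H = 0` and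
`div B = 0` (`entropy_flux_eq_zero`), and the induction equation preserves `div B = 0`. Hence `∂ₜH ≥
0` at the point, while minimality over the past forces `b ∂ₜH ≤ -ρ η < 0`: a contradiction
(`not_touching_from_below`).

If the entropy fell below its initial infimum, such a point would exist. The limit at infinity is
the same at all times, hence at least the initial infimum, and the minimization reduces to a compact
set. -/

open scoped Topology Laplacian

/-! ### Minima and convexity -/

/-- The second-order necessary condition for a local minimum along a direction. -/
theorem IsLocalMin.fderiv_fderiv_apply_self_nonneg {E : Type*} [NormedAddCommGroup E]
    [NormedSpace ℝ E] {f : E → ℝ} {x : E} (hmin : IsLocalMin f x) (hf : ContDiffAt ℝ 2 f x)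
    (v : E) : 0 ≤ fderiv ℝ (fderiv ℝ f) x v v := by
  set l : ℝ → E := fun r => x + r • v with hl
  have hlc : Continuous l := by fun_prop
  have hl0 : l 0 = x := by simp [hl]
  have hld : ∀ r, HasDerivAt l v r := fun r => by
    simpa [hl] using ((hasDerivAt_id r).smul_const v).const_add x
  have htend : Tendsto l (𝓝 0) (𝓝 x) := by simpa [hl0] using hlc.tendsto 0
  have hd : deriv (f ∘ l) =ᶠ[𝓝 0] fun r => fderiv ℝ f (l r) v := by
    have h1 : ∀ᶠ y in 𝓝 x, DifferentiableAt ℝ f y :=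
      (hf.eventually (by simp)).mono fun y hy => hy.differentiableAt (by norm_num)
    filter_upwards [htend.eventually h1] with r hr
    exact (hr.hasFDerivAt.comp_hasDerivAt r (hld r)).deriv
  have hfd : DifferentiableAt ℝ (fderiv ℝ f) x :=
    (hf.fderiv_right (m := 1) (by norm_num)).differentiableAt (by norm_num)
  have hdd : deriv (deriv (f ∘ l)) 0 = fderiv ℝ (fderiv ℝ f) x v v := by
    rw [hd.deriv_eq]
    have h2 : HasFDerivAt (fderiv ℝ f) (fderiv ℝ (fderiv ℝ f) x) (l 0) := by
      rw [hl0]; exact hfd.hasFDerivAt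
    have h3 := (h2.comp_hasDerivAt 0 (hld 0)).clm_apply (hasDerivAt_const (0 : ℝ) v)
    simpa using h3.deriv
  have hminl : IsLocalMin (f ∘ l) 0 := by
    have := htend.eventually hmin
    filter_upwards [this] with r hr
    simpa [hl0] using hr
  -- A negative second derivative would make `0` a local maximum too, so the function would be
  -- locally constant along the line and its second derivative zero.
  by_contra! hneg
  have hmaxl : IsLocalMax (f ∘ l) 0 := by
    refine isLocalMax_of_deriv_deriv_neg (by rwa [hdd]) hminl.deriv_eq_zero ?_
    refine ContinuousAt.comp ?_ hlc.continuousAt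
    rw [hl0]; exact hf.continuousAt
  have hconst : f ∘ l =ᶠ[𝓝 0] fun _ => (f ∘ l) 0 := by
    filter_upwards [hminl, hmaxl] with r h1 h2 using le_antisymm h2 h1
  have h0 : deriv (deriv (f ∘ l)) 0 = 0 := by
    rw [hconst.deriv.deriv_eq]; simp
  rw [hdd] at h0
  exact hneg.ne h0

/-- At a local minimum the Laplacian is nonnegative. -/
theorem IsLocalMin.laplacian_nonneg {E : Type*} [NormedAddCommGroup E]
    [InnerProductSpace ℝ E] [FiniteDimensional ℝ E] {f : E → ℝ} {x : E} (hmin : IsLocalMin f x)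
    (hf : ContDiffAt ℝ 2 f x) : 0 ≤ Δ f x := by
  rw [InnerProductSpace.laplacian_eq_iteratedFDeriv_stdOrthonormalBasis]
  refine Finset.sum_nonneg fun i _ => ?_
  rw [iteratedFDeriv_two_apply]
  exact hmin.fderiv_fderiv_apply_self_nonneg hf _

/-- A convex function lies above its tangent planes. -/
theorem ConvexOn.add_fderiv_le {E : Type*} [NormedAddCommGroup E] [NormedSpace ℝ E] {S : Set E}
    {f : E → ℝ} {f' : E →L[ℝ] ℝ} {x y : E} (hf : ConvexOn ℝ S f) (hx : x ∈ S) (hy : y ∈ S)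
    (hd : HasFDerivAt f f' x) : f x + f' (y - x) ≤ f y := by
  have hc := hf.comp_affineMap (AffineMap.lineMap x y : ℝ →ᵃ[ℝ] E)
  have hl : HasDerivAt (f ∘ (AffineMap.lineMap x y : ℝ →ᵃ[ℝ] E)) (f' (y - x)) 0 :=
    HasFDerivAt.comp_hasDerivAt 0 (by simpa using hd) AffineMap.hasDerivAt_lineMap
  have h := hc.le_slope_of_hasDerivAt (x := 0) (y := 1) (by simpa using hx) (by simpa using hy)
    one_pos hl
  rw [slope_def_field] at h
  simp only [Function.comp_apply, AffineMap.lineMap_apply_one, AffineMap.lineMap_apply_zero] at h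
  linarith

/-! ### Calculus of partial derivatives and commutation of derivatives -/

namespace MHD

variable {d : ℕ} {x : Space d} {f g : Space d → ℝ}

theorem partialDeriv_add (i : Fin d) (hf : DifferentiableAt ℝ f x) (hg : DifferentiableAt ℝ g x) :
    partialDeriv i (fun y => f y + g y) x = partialDeriv i f x + partialDeriv i g x := by
  simp [partialDeriv, fderiv_fun_add hf hg]

theorem partialDeriv_sub (i : Fin d) (hf : DifferentiableAt ℝ f x) (hg : DifferentiableAt ℝ g x) :
    partialDeriv i (fun y => f y - g y) x = partialDeriv i f x - partialDeriv i g x := by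
  simp [partialDeriv, fderiv_fun_sub hf hg]

theorem partialDeriv_mul (i : Fin d) (hf : DifferentiableAt ℝ f x) (hg : DifferentiableAt ℝ g x) :
    partialDeriv i (fun y => f y * g y) x
      = partialDeriv i f x * g x + f x * partialDeriv i g x := by
  simp [partialDeriv, fderiv_fun_mul hf hg]; ring

theorem partialDeriv_const_mul (i : Fin d) (c : ℝ) (hf : DifferentiableAt ℝ f x) :
    partialDeriv i (fun y => c * f y) x = c * partialDeriv i f x := by
  have := (hf.hasFDerivAt.const_mul c).fderiv
  simp [partialDeriv, this]

theorem partialDeriv_mul_const (i : Fin d) (c : ℝ) (hf : DifferentiableAt ℝ f x) :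
    partialDeriv i (fun y => f y * c) x = partialDeriv i f x * c := by
  simp_rw [mul_comm _ c]
  exact partialDeriv_const_mul i c hf

theorem partialDeriv_const (i : Fin d) (c : ℝ) : partialDeriv i (fun _ : Space d => c) x = 0 := by
  simp [partialDeriv]

theorem partialDeriv_sum {ι : Type*} (S : Finset ι) (i : Fin d) {F : ι → Space d → ℝ}
    (hF : ∀ k ∈ S, DifferentiableAt ℝ (F k) x) :
    partialDeriv i (fun y => ∑ k ∈ S, F k y) x = ∑ k ∈ S, partialDeriv i (F k) x := by
  simp [partialDeriv, fderiv_fun_sum hF]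

theorem partialDeriv_congr (i : Fin d) (h : f =ᶠ[𝓝 x] g) :
    partialDeriv i f x = partialDeriv i g x := by
  simp [partialDeriv, h.fderiv_eq]

theorem differentiableAt_partialDeriv (i : Fin d) (hf : ContDiffAt ℝ 2 f x) :
    DifferentiableAt ℝ (partialDeriv i f) x := by
  have hfd : DifferentiableAt ℝ (fderiv ℝ f) x :=
    (hf.fderiv_right (m := 1) (by norm_num)).differentiableAt (by norm_num)
  exact hfd.clm_apply (differentiableAt_const _)

theorem partialDeriv_partialDeriv (i j : Fin d) (hf : ContDiffAt ℝ 2 f x) :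
    partialDeriv i (partialDeriv j f) x
      = fderiv ℝ (fderiv ℝ f) x (EuclideanSpace.single i 1) (EuclideanSpace.single j 1) := by
  have hfd : DifferentiableAt ℝ (fderiv ℝ f) x :=
    (hf.fderiv_right (m := 1) (by norm_num)).differentiableAt (by norm_num)
  have := hfd.hasFDerivAt.clm_apply (hasFDerivAt_const (EuclideanSpace.single j (1 : ℝ)) x)
  change fderiv ℝ (fun y => fderiv ℝ f y (EuclideanSpace.single j 1)) x _ = _
  rw [this.fderiv]
  simp

theorem partialDeriv_comm (i j : Fin d) (hf : ContDiffAt ℝ 2 f x) :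
    partialDeriv i (partialDeriv j f) x = partialDeriv j (partialDeriv i f) x := by
  rw [partialDeriv_partialDeriv i j hf, partialDeriv_partialDeriv j i hf]
  exact (hf.isSymmSndFDerivAt (by simp)).eq _ _

/-- The divergence of the tensor divergence of an antisymmetric tensor field vanishes. -/
theorem divergence_tensorDivergence_eq_zero {A : Space d → Matrix (Fin d) (Fin d) ℝ}
    (hA : ∀ i j, ContDiffAt ℝ 2 (fun y => A y i j) x) (hanti : ∀ y i j, A y i j = -A y j i) :
    divergence (tensorDivergence A) x = 0 := by
  have h1 : divergence (tensorDivergence A) x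
      = ∑ j, ∑ i, partialDeriv j (partialDeriv i (fun y => A y i j)) x := by
    refine Finset.sum_congr rfl fun j _ => ?_
    exact partialDeriv_sum (F := fun i => partialDeriv i fun y => A y i j) Finset.univ j
      fun i _ => differentiableAt_partialDeriv i (hA i j)
  have h2 : ∀ i j, partialDeriv j (partialDeriv i (fun y => A y i j)) x
      = -partialDeriv i (partialDeriv j (fun y => A y j i)) x := by
    intro i j
    have : partialDeriv i (fun y => A y i j) = fun z => -1 * partialDeriv i (fun y => A y j i) z := by
      funext z
      simp_rw [hanti _ i j]
      simp [partialDeriv, fderiv_fun_neg]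
    rw [this, partialDeriv_const_mul _ _ (differentiableAt_partialDeriv i (hA j i)),
      partialDeriv_comm i j (hA j i)]
    ring
  -- Swapping the summation indices sends the double sum to its negative.
  have h3 : divergence (tensorDivergence A) x = -divergence (tensorDivergence A) x := by
    conv_rhs => rw [h1, Finset.sum_comm]
    rw [h1, ← Finset.sum_neg_distrib]
    refine Finset.sum_congr rfl fun j _ => ?_
    rw [← Finset.sum_neg_distrib]
    exact Finset.sum_congr rfl fun i _ => h2 i j
  linarith

theorem hasFDerivAt_prodMk_left (t : ℝ) (y : Space d) :
    HasFDerivAt (fun y : Space d => (t, y)) (ContinuousLinearMap.inr ℝ ℝ (Space d)) y :=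
  hasFDerivAt_prodMk_right t y

theorem hasDerivAt_prodMk_const (t : ℝ) (y : Space d) :
    HasDerivAt (fun τ : ℝ => (τ, y)) ((1, 0) : ℝ × Space d) t :=
  (hasDerivAt_id t).prodMk (hasDerivAt_const t y)

theorem partialDeriv_slice {F : ℝ × Space d → ℝ} {t : ℝ} (hF : DifferentiableAt ℝ F (t, x))
    (i : Fin d) : partialDeriv i (fun y => F (t, y)) x
      = fderiv ℝ F (t, x) (0, EuclideanSpace.single i 1) := by
  have := (hF.hasFDerivAt.comp x (hasFDerivAt_prodMk_left t x)).fderiv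
  simp only [Function.comp_def] at this
  simp [partialDeriv, this]

theorem deriv_slice {F : ℝ × Space d → ℝ} {t : ℝ} (hF : DifferentiableAt ℝ F (t, x)) :
    deriv (fun τ => F (τ, x)) t = fderiv ℝ F (t, x) (1, 0) :=
  (hF.hasFDerivAt.comp_hasDerivAt t (hasDerivAt_prodMk_const t x)).deriv

/-- Time and space derivatives of a `C²` function commute. -/
theorem hasDerivAt_partialDeriv {F : ℝ × Space d → ℝ} {t : ℝ}
    (hF : ContDiffAt ℝ 2 F (t, x)) (i : Fin d) :
    HasDerivAt (fun τ => partialDeriv i (fun y => F (τ, y)) x)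
      (partialDeriv i (fun y => deriv (fun τ => F (τ, y)) t) x) t := by
  have hev : ∀ᶠ q in 𝓝 (t, x), DifferentiableAt ℝ F q :=
    (hF.eventually (by simp)).mono fun q hq => hq.differentiableAt (by norm_num)
  have hfd : DifferentiableAt ℝ (fderiv ℝ F) (t, x) :=
    (hF.fderiv_right (m := 1) (by norm_num)).differentiableAt (by norm_num)
  have happ : ∀ v : ℝ × Space d, HasFDerivAt (fun q => fderiv ℝ F q v)
      ((fderiv ℝ (fderiv ℝ F) (t, x)).flip v) (t, x) := fun v => by
    have := hfd.hasFDerivAt.clm_apply (hasFDerivAt_const v (t, x))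
    simpa using this
  have e1 : (fun τ => partialDeriv i (fun y => F (τ, y)) x) =ᶠ[𝓝 t]
      fun τ => fderiv ℝ F (τ, x) (0, EuclideanSpace.single i 1) := by
    have : Tendsto (fun τ : ℝ => (τ, x)) (𝓝 t) (𝓝 (t, x)) :=
      (hasDerivAt_prodMk_const t x).continuousAt
    filter_upwards [this.eventually hev] with τ h using partialDeriv_slice h i
  have e2 : (fun y => deriv (fun τ => F (τ, y)) t) =ᶠ[𝓝 x] fun y => fderiv ℝ F (t, y) (1, 0) := by
    have : Tendsto (fun y : Space d => (t, y)) (𝓝 x) (𝓝 (t, x)) :=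
      (hasFDerivAt_prodMk_left t x).continuousAt
    filter_upwards [this.eventually hev] with y h using deriv_slice h
  rw [partialDeriv_congr i e2, partialDeriv_slice (happ _).differentiableAt i, (happ _).fderiv,
    ContinuousLinearMap.flip_apply, (hF.isSymmSndFDerivAt (by simp)).eq]
  exact ((happ _).comp_hasDerivAt t (hasDerivAt_prodMk_const t x)).congr_of_eventuallyEq e1

end MHD

/-! ### Derivatives of the fluxes and their cancellation -/

namespace MHD.Flow

variable {d : ℕ} {u : Flow d} {s : ℝ → ℝ → ℝ} {μ t : ℝ} {x : Space d}

theorem magneticEnergy_eq_sum (y : Space d) :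
    u.magneticEnergy μ t y = (2 * μ)⁻¹ * ∑ k, u.mag t y k * u.mag t y k := by
  simp only [magneticEnergy, EuclideanSpace.norm_sq_eq, Real.norm_eq_abs, sq_abs, div_eq_inv_mul]
  simp only [pow_two]

theorem differentiableAt_magneticEnergy (hB : ∀ j, DifferentiableAt ℝ (fun y => u.mag t y j) x) :
    DifferentiableAt ℝ (u.magneticEnergy μ t) x := by
  have : u.magneticEnergy μ t = fun y => (2 * μ)⁻¹ * ∑ k, u.mag t y k * u.mag t y k :=
    funext magneticEnergy_eq_sum
  rw [this]
  fun_prop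

theorem partialDeriv_magneticEnergy (hμ : 0 < μ)
    (hB : ∀ j, DifferentiableAt ℝ (fun y => u.mag t y j) x) (i : Fin d) :
    partialDeriv i (u.magneticEnergy μ t) x
      = μ⁻¹ * ∑ k, u.mag t x k * partialDeriv i (fun y => u.mag t y k) x := by
  have : u.magneticEnergy μ t = fun y => (2 * μ)⁻¹ * ∑ k, u.mag t y k * u.mag t y k :=
    funext magneticEnergy_eq_sum
  rw [this, partialDeriv_const_mul i _ (by fun_prop),
    partialDeriv_sum (F := fun k y => u.mag t y k * u.mag t y k) Finset.univ i
      (fun k _ => (hB k).mul (hB k)), Finset.mul_sum, Finset.mul_sum]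
  refine Finset.sum_congr rfl fun k _ => ?_
  rw [partialDeriv_mul i (hB k) (hB k)]
  field_simp
  ring

theorem velocity_apply (y : Space d) (j : Fin d) :
    u.velocity t y j = (u.rho t y)⁻¹ * u.mom t y j := by
  simp [velocity]

theorem momentum_apply (hρ : 0 < u.rho t x) (j : Fin d) :
    u.mom t x j = u.rho t x * u.velocity t x j := by
  rw [velocity_apply]; field_simp

theorem differentiableAt_velocity (hρ : 0 < u.rho t x) (hr : DifferentiableAt ℝ (u.rho t) x)
    {j : Fin d} (hm : DifferentiableAt ℝ (fun y => u.mom t y j) x) :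
    DifferentiableAt ℝ (fun y => u.velocity t y j) x := by
  simp_rw [velocity_apply]
  exact (hr.inv hρ.ne').mul hm

theorem rho_mul_specificInternalEnergy (hρ : 0 < u.rho t x) :
    u.rho t x * u.specificInternalEnergy μ t x
      = u.energy t x - u.rho t x * (∑ k, u.velocity t x k * u.velocity t x k) / 2
        - u.magneticEnergy μ t x := by
  have h : ‖u.mom t x‖ ^ 2
      = u.rho t x * (u.rho t x * ∑ k, u.velocity t x k * u.velocity t x k) := by
    simp only [EuclideanSpace.norm_sq_eq, Real.norm_eq_abs, sq_abs, Finset.mul_sum]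
    refine Finset.sum_congr rfl fun k _ => ?_
    rw [momentum_apply hρ]; ring
  rw [specificInternalEnergy, h]
  field_simp

theorem partialDeriv_momentumFlux (hw : ∀ j, DifferentiableAt ℝ (fun y => u.velocity t y j) x)
    (hm : ∀ j, DifferentiableAt ℝ (fun y => u.mom t y j) x)
    (hB : ∀ j, DifferentiableAt ℝ (fun y => u.mag t y j) x)
    (hp : DifferentiableAt ℝ (u.pressureField s μ t) x) (i j : Fin d) :
    partialDeriv i (fun y => u.momentumFlux s μ t y i j) x
      = partialDeriv i (fun y => u.mom t y i) x * u.velocity t x j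
        + u.mom t x i * partialDeriv i (fun y => u.velocity t y j) x
        - μ⁻¹ * (partialDeriv i (fun y => u.mag t y i) x * u.mag t x j
          + u.mag t x i * partialDeriv i (fun y => u.mag t y j) x)
        + (partialDeriv i (u.pressureField s μ t) x + partialDeriv i (u.magneticEnergy μ t) x)
          * (if i = j then 1 else 0) := by
  have : (fun y => u.momentumFlux s μ t y i j) = fun y =>
      u.mom t y i * u.velocity t y j - μ⁻¹ * (u.mag t y i * u.mag t y j)
      + (u.pressureField s μ t y + u.magneticEnergy μ t y) * (if i = j then 1 else 0) := by
    funext y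
    simp only [momentumFlux, outer, velocity_apply, Matrix.add_apply, Matrix.sub_apply,
      Matrix.smul_apply, Matrix.of_apply, Matrix.one_apply, smul_eq_mul]
    ring
  have hme : DifferentiableAt ℝ (u.magneticEnergy μ t) x := differentiableAt_magneticEnergy hB
  have h1 := hm i
  have h2 := hw j
  have h3 := hB i
  have h4 := hB j
  rw [this, partialDeriv_add i ((h1.fun_mul h2).fun_sub ((h3.fun_mul h4).const_mul _))
      ((hp.fun_add hme).mul_const _),
    partialDeriv_sub i (h1.fun_mul h2) ((h3.fun_mul h4).const_mul _),
    partialDeriv_mul i h1 h2, partialDeriv_const_mul i _ (h3.fun_mul h4),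
    partialDeriv_mul i h3 h4, partialDeriv_mul_const i _ (hp.fun_add hme),
    partialDeriv_add i hp hme]

theorem partialDeriv_inductionFlux (hw : ∀ j, DifferentiableAt ℝ (fun y => u.velocity t y j) x)
    (hB : ∀ j, DifferentiableAt ℝ (fun y => u.mag t y j) x) (i j : Fin d) :
    partialDeriv i (fun y => u.inductionFlux t y i j) x
      = partialDeriv i (fun y => u.velocity t y i) x * u.mag t x j
        + u.velocity t x i * partialDeriv i (fun y => u.mag t y j) x
        - (partialDeriv i (fun y => u.mag t y i) x * u.velocity t x j
        + u.mag t x i * partialDeriv i (fun y => u.velocity t y j) x) := by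
  have : (fun y => u.inductionFlux t y i j) = fun y =>
      u.velocity t y i * u.mag t y j - u.mag t y i * u.velocity t y j := by
    funext y
    simp only [inductionFlux, outer, velocity_apply, Matrix.sub_apply,
      Matrix.smul_apply, Matrix.of_apply, smul_eq_mul]
    ring
  have h1 := hw i
  have h2 := hw j
  have h3 := hB i
  have h4 := hB j
  rw [this, partialDeriv_sub i (h1.fun_mul h4) (h3.fun_mul h2), partialDeriv_mul i h1 h4,
    partialDeriv_mul i h3 h2]

theorem partialDeriv_energyFlux (hw : ∀ j, DifferentiableAt ℝ (fun y => u.velocity t y j) x)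
    (hE : DifferentiableAt ℝ (u.energy t) x)
    (hB : ∀ j, DifferentiableAt ℝ (fun y => u.mag t y j) x)
    (hp : DifferentiableAt ℝ (u.pressureField s μ t) x) (i : Fin d) :
    partialDeriv i (fun y => u.energyFlux s μ t y i) x
      = (partialDeriv i (u.energy t) x + partialDeriv i (u.pressureField s μ t) x
          + partialDeriv i (u.magneticEnergy μ t) x) * u.velocity t x i
        + (u.energy t x + u.pressureField s μ t x + u.magneticEnergy μ t x)
          * partialDeriv i (fun y => u.velocity t y i) x
        - μ⁻¹ * ((∑ k, (partialDeriv i (fun y => u.mag t y k) x * u.velocity t x k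
            + u.mag t x k * partialDeriv i (fun y => u.velocity t y k) x)) * u.mag t x i
          + (∑ k, u.mag t x k * u.velocity t x k)
            * partialDeriv i (fun y => u.mag t y i) x) := by
  have : (fun y => u.energyFlux s μ t y i) = fun y =>
      (u.energy t y + u.pressureField s μ t y + u.magneticEnergy μ t y) * u.velocity t y i
      - μ⁻¹ * ((∑ k, u.mag t y k * u.velocity t y k) * u.mag t y i) := by
    funext y
    simp only [energyFlux, PiLp.inner_apply, PiLp.sub_apply, PiLp.smul_apply, smul_eq_mul,
      RCLike.inner_apply, conj_trivial, mul_comm (u.mag t y _) (u.velocity t y _), mul_assoc]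
  have hme : DifferentiableAt ℝ (u.magneticEnergy μ t) x := differentiableAt_magneticEnergy hB
  have hs : DifferentiableAt ℝ (fun y => ∑ k, u.mag t y k * u.velocity t y k) x :=
    DifferentiableAt.fun_sum fun k _ => (hB k).fun_mul (hw k)
  have hs' : partialDeriv i (fun y => ∑ k, u.mag t y k * u.velocity t y k) x
      = ∑ k, (partialDeriv i (fun y => u.mag t y k) x * u.velocity t x k
            + u.mag t x k * partialDeriv i (fun y => u.velocity t y k) x) := by
    rw [partialDeriv_sum (F := fun k y => u.mag t y k * u.velocity t y k) Finset.univ i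
      (fun k _ => (hB k).fun_mul (hw k))]
    exact Finset.sum_congr rfl fun k _ => partialDeriv_mul i (hB k) (hw k)
  have h2 := hw i
  have h3 := hB i
  have hEp := hE.fun_add hp
  have hEpm := hEp.fun_add hme
  rw [this, partialDeriv_sub i (hEpm.fun_mul h2) ((hs.fun_mul h3).const_mul _),
    partialDeriv_mul i hEpm h2, partialDeriv_const_mul i _ (hs.fun_mul h3),
    partialDeriv_mul i hs h3, hs', partialDeriv_add i hEp hme, partialDeriv_add i hE hp]

/-- Contracting first in the component index leaves a single sum over the direction of
differentiation `i`. With the next lemma, this lets the fluxes be compared direction by direction.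
-/
theorem sum_mul_inductionFlux_deriv {ι : Type*} [Fintype ι] (w b : ι → ℝ) (W D : ι → ι → ℝ) :
    ∑ j, b j * ∑ i, (W i i * b j + w i * D i j - (D i i * w j + b i * W i j))
      = ∑ i, (W i i * ∑ k, b k * b k + w i * ∑ k, b k * D i k
        - (D i i * ∑ k, b k * w k + b i * ∑ k, b k * W i k)) := by
  simp_rw [Finset.mul_sum]
  rw [Finset.sum_comm]
  refine Finset.sum_congr rfl fun i _ => ?_
  simp only [← Finset.sum_add_distrib, ← Finset.sum_sub_distrib]
  exact Finset.sum_congr rfl fun j _ => by ring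

theorem sum_mul_momentumFlux_deriv {ι : Type*} [Fintype ι] [DecidableEq ι] (w m b q M : ι → ℝ)
    (W D : ι → ι → ℝ) (c : ℝ) :
    ∑ j, w j * ∑ i, (M i * w j + m i * W i j - c * (D i i * b j + b i * D i j)
        + q i * (if i = j then 1 else 0))
      = ∑ i, (M i * ∑ k, w k * w k + m i * ∑ k, w k * W i k
        - c * (D i i * ∑ k, b k * w k + b i * ∑ k, D i k * w k) + w i * q i) := by
  simp_rw [Finset.mul_sum]
  rw [Finset.sum_comm]
  refine Finset.sum_congr rfl fun i _ => ?_
  have h : w i * q i = ∑ j, w j * (q i * (if i = j then 1 else 0)) := by simp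
  rw [h]
  simp only [← Finset.sum_add_distrib, ← Finset.sum_sub_distrib, Finset.mul_sum]
  exact Finset.sum_congr rfl fun j _ => by ring

/-- The combination of the inviscid fluxes that governs the specific entropy vanishes wherever
the entropy gradient and the divergence of the magnetic field do. -/
theorem entropy_flux_eq_zero (hμ : 0 < μ) (hρ : ∀ y, 0 < u.rho t y)
    (hr : DifferentiableAt ℝ (u.rho t) x) (hm : ∀ j, DifferentiableAt ℝ (fun y => u.mom t y j) x)
    (hE : DifferentiableAt ℝ (u.energy t) x)
    (hB : ∀ j, DifferentiableAt ℝ (fun y => u.mag t y j) x)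
    (hp : DifferentiableAt ℝ (u.pressureField s μ t) x)
    (hdiv : divergence (u.mag t) x = 0)
    {κ : ℝ} (hκ : κ = (∑ k, u.velocity t x k * u.velocity t x k) / 2
      - u.specificInternalEnergy μ t x - (u.rho t x)⁻¹ * u.pressureField s μ t x)
    (hgrad : ∀ i, partialDeriv i (fun y => u.energy t y - u.magneticEnergy μ t y) x
      - ∑ j, u.velocity t x j * partialDeriv i (fun y => u.mom t y j) x
      + κ * partialDeriv i (u.rho t) x = 0) :
    divergence (u.energyFlux s μ t) x
      - μ⁻¹ * ∑ j, u.mag t x j * tensorDivergence (u.inductionFlux t) x j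
      - ∑ j, u.velocity t x j * tensorDivergence (u.momentumFlux s μ t) x j
      + κ * divergence (u.mom t) x = 0 := by
  have hw : ∀ j, DifferentiableAt ℝ (fun y => u.velocity t y j) x := fun j =>
    differentiableAt_velocity (hρ x) hr (hm j)
  have hme : DifferentiableAt ℝ (u.magneticEnergy μ t) x := differentiableAt_magneticEnergy hB
  have dM : ∀ i j, partialDeriv i (fun y => u.mom t y j) x
      = partialDeriv i (u.rho t) x * u.velocity t x j
        + u.rho t x * partialDeriv i (fun y => u.velocity t y j) x := fun i j => by
    rw [← partialDeriv_mul i hr (hw j)]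
    congr 1; funext y; exact momentum_apply (hρ y) j
  have he := rho_mul_specificInternalEnergy (μ := μ) (hρ x)
  have hY := magneticEnergy_eq_sum (u := u) (μ := μ) (t := t) x
  have dme := partialDeriv_magneticEnergy hμ hB
  simp_rw [partialDeriv_sub _ hE hme] at hgrad
  simp only [tensorDivergence, divergence] at hdiv ⊢
  simp_rw [partialDeriv_momentumFlux hw hm hB hp, partialDeriv_inductionFlux hw hB,
    partialDeriv_energyFlux hw hE hB hp]
  rw [sum_mul_inductionFlux_deriv (u.velocity t x) (u.mag t x)
      (fun i j => partialDeriv i (fun y => u.velocity t y j) x)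
      (fun i j => partialDeriv i (fun y => u.mag t y j) x),
    sum_mul_momentumFlux_deriv (u.velocity t x) (u.mom t x) (u.mag t x)
      (fun i => partialDeriv i (u.pressureField s μ t) x
        + partialDeriv i (u.magneticEnergy μ t) x)
      (fun i => partialDeriv i (fun y => u.mom t y i) x)
      (fun i j => partialDeriv i (fun y => u.velocity t y j) x)
      (fun i j => partialDeriv i (fun y => u.mag t y j) x)]
  have hsum : ∀ i, ∑ j, u.velocity t x j * partialDeriv i (fun y => u.mom t y j) x
      = partialDeriv i (u.rho t) x * (∑ k, u.velocity t x k * u.velocity t x k)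
        + u.rho t x * ∑ k, u.velocity t x k * partialDeriv i (fun y => u.velocity t y k) x := by
    intro i
    rw [Finset.mul_sum, Finset.mul_sum, ← Finset.sum_add_distrib]
    exact Finset.sum_congr rfl fun j _ => by rw [dM]; ring
  simp_rw [hsum, dme] at hgrad
  simp_rw [dM, momentum_apply (hρ x), dme, Finset.sum_add_distrib (f := fun k => _ * _)]
  set X := ∑ k, u.mag t x k * u.velocity t x k
  set Y := ∑ k, u.mag t x k * u.mag t x k
  set Q := ∑ k, u.velocity t x k * u.velocity t x k
  -- Of the terms `μ⁻¹ (B·w) ∂_i B_i` from the energy, induction and momentum fluxes, one survives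
  -- in total. Writing `0` as the corresponding multiple of `div B` makes the identity hold for each
  -- `i` separately.
  have hX : (0 : ℝ) = ∑ i, (μ⁻¹ * X) * partialDeriv i (fun y => u.mag t y i) x := by
    rw [← Finset.mul_sum, hdiv, mul_zero]
  rw [← Finset.sum_add_distrib (f := fun i => partialDeriv i (u.rho t) x * u.velocity t x i),
    Finset.mul_sum, Finset.mul_sum, ← Finset.sum_sub_distrib, ← Finset.sum_sub_distrib,
    ← Finset.sum_add_distrib, hX]
  refine Finset.sum_congr rfl fun i _ => ?_
  have hP : ∑ k, partialDeriv i (fun y => u.mag t y k) x * u.velocity t x k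
      = ∑ k, u.velocity t x k * partialDeriv i (fun y => u.mag t y k) x :=
    Finset.sum_congr rfl fun k _ => mul_comm _ _
  have hgi := hgrad i
  simp only [hP]
  generalize (∑ k, u.velocity t x k * partialDeriv i (fun y => u.mag t y k) x) = P at *
  generalize (∑ k, u.mag t x k * partialDeriv i (fun y => u.mag t y k) x) = S at *
  generalize (∑ k, u.velocity t x k * partialDeriv i (fun y => u.velocity t y k) x) = V at *
  generalize (∑ k, u.mag t x k * partialDeriv i (fun y => u.velocity t y k) x) = Z at *
  generalize partialDeriv i (fun y => u.velocity t y i) x = Wi at *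
  generalize partialDeriv i (fun y => u.mag t y i) x = Bi at *
  generalize partialDeriv i (u.rho t) x = Ri at *
  generalize partialDeriv i (u.energy t) x = Ei at *
  generalize partialDeriv i (u.pressureField s μ t) x = Pi at *
  rw [hY] at he ⊢
  have hr0 : (u.rho t x)⁻¹ * u.rho t x = 1 := inv_mul_cancel₀ (hρ x).ne'
  have h2 : (2 * μ)⁻¹ = μ⁻¹ / 2 := by rw [mul_inv]; ring
  rw [h2] at he ⊢
  -- The transport terms are `w_i` times the `i`-th component of the vanishing gradient; the terms
  -- in `∂_i w_i` cancel by the choice of `κ` and the decomposition of the energy.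
  linear_combination (u.velocity t x i) * hgi + (u.rho t x * Wi) * hκ - Wi * he - (u.pressureField s μ t x * Wi) * hr0

end MHD.Flow

/-- A function that is minimal at `t` among earlier times has a nonpositive derivative there. -/
theorem HasDerivAt.nonpos_of_forall_left_le {f : ℝ → ℝ} {f' t : ℝ} (hf : HasDerivAt f f' t)
    (h : ∀ᶠ τ in 𝓝[<] t, f t ≤ f τ) : f' ≤ 0 := by
  have h1 : Tendsto (slope f t) (𝓝[<] t) (𝓝 f') :=
    (hasDerivAt_iff_tendsto_slope.1 hf).mono_left (nhdsWithin_mono _ fun y hy => ne_of_lt hy)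
  refine le_of_tendsto h1 ?_
  filter_upwards [h, self_mem_nhdsWithin] with τ h2 h3
  rw [slope_def_field]
  exact div_nonpos_of_nonneg_of_nonpos (sub_nonneg.2 h2) (sub_nonpos.2 (le_of_lt h3))

/-! ### Thermodynamics: the pressure and the tangent plane of the entropy -/

namespace MHD

theorem isOpen_positiveQuadrant : IsOpen positiveQuadrant := isOpen_Ioi.prod isOpen_Ioi

namespace IsAdmissibleEntropy

variable {s : ℝ → ℝ → ℝ}

theorem contDiffAt (hs : IsAdmissibleEntropy s) {ρ e : ℝ} (hρ : 0 < ρ) (he : 0 < e) :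
    ContDiffAt ℝ 2 (fun q : ℝ × ℝ => s q.1 q.2) (ρ, e) :=
  hs.smooth.contDiffAt (isOpen_positiveQuadrant.mem_nhds ⟨hρ, he⟩)

theorem hasFDerivAt (hs : IsAdmissibleEntropy s) {ρ e : ℝ} (hρ : 0 < ρ) (he : 0 < e) :
    HasFDerivAt (fun q : ℝ × ℝ => s q.1 q.2) (fderiv ℝ (fun q : ℝ × ℝ => s q.1 q.2) (ρ, e))
      (ρ, e) :=
  ((hs.contDiffAt hρ he).differentiableAt (by norm_num)).hasFDerivAt

theorem entropyRho_eq (hs : IsAdmissibleEntropy s) {ρ e : ℝ} (hρ : 0 < ρ) (he : 0 < e) :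
    entropyRho s ρ e = fderiv ℝ (fun q : ℝ × ℝ => s q.1 q.2) (ρ, e) (1, 0) :=
  ((hs.hasFDerivAt hρ he).comp_hasDerivAt (f := fun r => (r, e)) ρ
    ((hasDerivAt_id ρ).prodMk (hasDerivAt_const ρ e))).deriv

theorem entropyE_eq (hs : IsAdmissibleEntropy s) {ρ e : ℝ} (hρ : 0 < ρ) (he : 0 < e) :
    entropyE s ρ e = fderiv ℝ (fun q : ℝ × ℝ => s q.1 q.2) (ρ, e) (0, 1) :=
  ((hs.hasFDerivAt hρ he).comp_hasDerivAt (f := fun a => (ρ, a)) e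
    ((hasDerivAt_const e ρ).prodMk (hasDerivAt_id e))).deriv

/-- The pressure contains first derivatives of `s` and is differentiated once in the fluxes; this is
where second-order regularity of `s` is needed. -/
theorem differentiableAt_pressure (hs : IsAdmissibleEntropy s) {ρ e : ℝ} (hρ : 0 < ρ)
    (he : 0 < e) : DifferentiableAt ℝ (fun q : ℝ × ℝ => pressure s q.1 q.2) (ρ, e) := by
  have hfd : DifferentiableAt ℝ (fderiv ℝ (fun q : ℝ × ℝ => s q.1 q.2)) (ρ, e) :=
    ((hs.contDiffAt hρ he).fderiv_right (m := 1) (by norm_num)).differentiableAt (by norm_num)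
  have h1 : (fun q : ℝ × ℝ => pressure s q.1 q.2) =ᶠ[𝓝 (ρ, e)] fun q =>
      -(q.1 ^ 2 * fderiv ℝ (fun q : ℝ × ℝ => s q.1 q.2) q (1, 0)
        / fderiv ℝ (fun q : ℝ × ℝ => s q.1 q.2) q (0, 1)) := by
    filter_upwards [isOpen_positiveQuadrant.mem_nhds (⟨hρ, he⟩ : (ρ, e) ∈ positiveQuadrant)]
      with q hq
    rw [pressure, hs.entropyRho_eq hq.1 hq.2, hs.entropyE_eq hq.1 hq.2]
  refine DifferentiableAt.congr_of_eventuallyEq ?_ h1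
  have h0 : fderiv ℝ (fun q : ℝ × ℝ => s q.1 q.2) (ρ, e) (0, 1) ≠ 0 := by
    rw [← hs.entropyE_eq hρ he]; exact (hs.temperature_pos ρ e hρ he).ne'
  have h2 : ∀ v : ℝ × ℝ, DifferentiableAt ℝ
      (fun q => fderiv ℝ (fun q : ℝ × ℝ => s q.1 q.2) q v) (ρ, e) := fun v =>
    hfd.clm_apply (differentiableAt_const v)
  have h3 : DifferentiableAt ℝ (fun q : ℝ × ℝ => q.1 ^ 2) (ρ, e) := by fun_prop
  simp only [div_eq_mul_inv]
  exact ((h3.fun_mul (h2 (1, 0))).fun_mul ((h2 (0, 1)).fun_inv h0)).fun_neg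

/-- The concave entropy lies below its tangent plane in the variables `(1/ρ, e)`. -/
theorem le_tangent (hs : IsAdmissibleEntropy s) {ρ₀ e₀ ρ e : ℝ} (hρ₀ : 0 < ρ₀) (he₀ : 0 < e₀)
    (hρ : 0 < ρ) (he : 0 < e) :
    s ρ e ≤ s ρ₀ e₀
      + entropyE s ρ₀ e₀ * (pressure s ρ₀ e₀ * (ρ⁻¹ - ρ₀⁻¹) + (e - e₀)) := by
  -- The base point is written as the image of `v₀ = ρ₀⁻¹` under inversion, the form required by the
  -- chain rule in the variables `(v, e)`.
  have h1 : HasFDerivAt (fun q : ℝ × ℝ => s q.1 q.2)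
      (fderiv ℝ (fun q : ℝ × ℝ => s q.1 q.2) (ρ₀, e₀)) (ρ₀⁻¹⁻¹, e₀) := by
    rw [inv_inv]; exact hs.hasFDerivAt hρ₀ he₀
  have h2 := ((hasDerivAt_inv (inv_ne_zero hρ₀.ne')).comp_hasFDerivAt (f := Prod.fst)
    (ρ₀⁻¹, e₀) hasFDerivAt_fst).prodMk (hasFDerivAt_snd (𝕜 := ℝ) (p := (ρ₀⁻¹, e₀)))
  have h3 := (HasFDerivAt.comp (ρ₀⁻¹, e₀) h1 h2).neg
  have h4 := hs.strictConvex.convexOn.add_fderiv_le (x := (ρ₀⁻¹, e₀)) (y := (ρ⁻¹, e))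
    ⟨inv_pos.2 hρ₀, he₀⟩ ⟨inv_pos.2 hρ, he⟩ h3
  simp only [inv_inv, neg_apply, ContinuousLinearMap.comp_apply,
    ContinuousLinearMap.prod_apply, smul_apply, Prod.mk_sub_mk,
    ContinuousLinearMap.coe_fst', ContinuousLinearMap.coe_snd', smul_eq_mul] at h4
  have h5 : ∀ a b : ℝ, fderiv ℝ (fun q : ℝ × ℝ => s q.1 q.2) (ρ₀, e₀) (a, b)
      = a * entropyRho s ρ₀ e₀ + b * entropyE s ρ₀ e₀ := fun a b => by
    rw [hs.entropyRho_eq hρ₀ he₀, hs.entropyE_eq hρ₀ he₀, ← smul_eq_mul, ← smul_eq_mul,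
      ← map_smul, ← map_smul, ← map_add]
    simp
  rw [h5] at h4
  -- The Gibbs identity `∂s/∂v = s_e p`, since `∂s/∂v = -ρ² s_ρ`.
  have h6 : entropyE s ρ₀ e₀ * pressure s ρ₀ e₀ = -(ρ₀ ^ 2 * entropyRho s ρ₀ e₀) := by
    rw [pressure]
    have := (hs.temperature_pos ρ₀ e₀ hρ₀ he₀).ne'
    field_simp
  have h7 : -((ρ₀⁻¹) ^ 2)⁻¹ = - ρ₀ ^ 2 := by rw [inv_pow, inv_inv]
  rw [h7] at h4
  linear_combination h4 - (ρ⁻¹ - ρ₀⁻¹) * h6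

end IsAdmissibleEntropy

/-! ### Regularity of the flow and propagation of `div B = 0` -/

namespace Flow

variable {d : ℕ} {u : Flow d} {s : ℝ → ℝ → ℝ} {ε μ T t : ℝ} {x : Space d}

theorem specificInternalEnergy_contDiffOn {Ω : Set (ℝ × Space d)}
    (hr : ContDiffOn ℝ 2 (fun q : ℝ × Space d => u.rho q.1 q.2) Ω)
    (hm : ContDiffOn ℝ 2 (fun q : ℝ × Space d => u.mom q.1 q.2) Ω)
    (hE : ContDiffOn ℝ 2 (fun q : ℝ × Space d => u.energy q.1 q.2) Ω)
    (hB : ContDiffOn ℝ 2 (fun q : ℝ × Space d => u.mag q.1 q.2) Ω)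
    (hρ : ∀ q ∈ Ω, 0 < u.rho q.1 q.2) :
    ContDiffOn ℝ 2 (fun q : ℝ × Space d => u.specificInternalEnergy μ q.1 q.2) Ω := by
  unfold specificInternalEnergy magneticEnergy
  refine (hr.inv fun q hq => (hρ q hq).ne').mul
    ((hE.sub ((hm.norm_sq ℝ).div (contDiffOn_const.mul hr) fun q hq => ?_)).sub
      ((hB.norm_sq ℝ).div_const _))
  have := hρ q hq
  positivity

namespace IsSmoothSolution

theorem contDiffOn_specificInternalEnergy (hu : u.IsSmoothSolution s ε μ T) :
    ContDiffOn ℝ 2 (fun q : ℝ × Space d => u.specificInternalEnergy μ q.1 q.2)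
      (Icc 0 T ×ˢ univ) :=
  specificInternalEnergy_contDiffOn hu.smooth_rho hu.smooth_mom hu.smooth_energy hu.smooth_mag
    fun q hq => hu.rho_pos q.1 hq.1 q.2

theorem slab_mem_nhds (ht : t ∈ Ioo 0 T) :
    (Icc 0 T ×ˢ univ : Set (ℝ × Space d)) ∈ 𝓝 (t, x) :=
  prod_mem_nhds (Icc_mem_nhds ht.1 ht.2) univ_mem

theorem contDiffAt_mag_apply (hu : u.IsSmoothSolution s ε μ T) (ht : t ∈ Ioo 0 T) (j : Fin d) :
    ContDiffAt ℝ 2 (fun q : ℝ × Space d => u.mag q.1 q.2 j) (t, x) :=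
  contDiffAt_piLp 2 |>.1 (hu.smooth_mag.contDiffAt (slab_mem_nhds ht)) j

theorem contDiffAt_mom_apply (hu : u.IsSmoothSolution s ε μ T) (ht : t ∈ Ioo 0 T) (j : Fin d) :
    ContDiffAt ℝ 2 (fun q : ℝ × Space d => u.mom q.1 q.2 j) (t, x) :=
  contDiffAt_piLp 2 |>.1 (hu.smooth_mom.contDiffAt (slab_mem_nhds ht)) j

theorem _root_.ContDiffAt.slice {F : Type*} [NormedAddCommGroup F] [NormedSpace ℝ F]
    {f : ℝ × Space d → F} (hf : ContDiffAt ℝ 2 f (t, x)) :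
    ContDiffAt ℝ 2 (fun y => f (t, y)) x :=
  ContDiffAt.comp x hf (contDiffAt_const.prodMk contDiffAt_id)

theorem _root_.ContDiffAt.differentiableAt_time {F : Type*} [NormedAddCommGroup F]
    [NormedSpace ℝ F] {f : ℝ × Space d → F} (hf : ContDiffAt ℝ 2 f (t, x)) :
    DifferentiableAt ℝ (fun τ => f (τ, x)) t :=
  DifferentiableAt.comp t (hf.differentiableAt (by norm_num))
    (hasDerivAt_prodMk_const t x).differentiableAt

theorem differentiableAt_pressureField (hs : IsAdmissibleEntropy s)
    (hu : u.IsSmoothSolution s ε μ T) (ht : t ∈ Ioo 0 T) :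
    DifferentiableAt ℝ (u.pressureField s μ t) x := by
  have ht' : t ∈ Icc 0 T := Ioo_subset_Icc_self ht
  have h1 := (hu.smooth_rho.contDiffAt (slab_mem_nhds (x := x) ht)).slice.differentiableAt
    (by norm_num)
  have h2 := (hu.contDiffOn_specificInternalEnergy.contDiffAt
    (slab_mem_nhds (x := x) ht)).slice.differentiableAt (by norm_num)
  exact DifferentiableAt.comp (f := fun y => (u.rho t y, u.specificInternalEnergy μ t y)) x
    (hs.differentiableAt_pressure (hu.rho_pos t ht' x) (hu.internalEnergy_pos t ht' x))
    (h1.prodMk h2)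

theorem hasDerivAt_mag_apply (hu : u.IsSmoothSolution s ε μ T) (ht : t ∈ Ioo 0 T) (j : Fin d) :
    HasDerivAt (fun τ => u.mag τ x j) (-tensorDivergence (u.inductionFlux t) x j) t := by
  have h1 := (hu.smooth_mag.contDiffAt (slab_mem_nhds (x := x) ht)).differentiableAt_time
  have h2 := (EuclideanSpace.proj j : Space d →L[ℝ] ℝ).hasFDerivAt.comp_hasDerivAt t h1.hasDerivAt
  have h3 : deriv (fun τ => u.mag τ x) t = -tensorDivergence (u.inductionFlux t) x :=
    eq_neg_of_add_eq_zero_left (hu.induction t ht x)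
  rw [h3] at h2
  exact h2

/-- The equations hold only for `0 < t < T`, so the initial condition on `div B` is reached by
continuity up to `t = 0`. There only derivatives within the closed slab are controlled, but their
spatial components are the ordinary ones. -/
theorem continuousOn_partialDeriv_slice {F : ℝ × Space d → ℝ} (hT : 0 < T)
    (hF : ContDiffOn ℝ 2 F (Icc 0 T ×ˢ univ)) (i : Fin d) :
    ContinuousOn (fun τ => partialDeriv i (fun y => F (τ, y)) x) (Icc 0 T) := by
  have hud : UniqueDiffOn ℝ (Icc 0 T ×ˢ univ : Set (ℝ × Space d)) :=
    (uniqueDiffOn_Icc hT).prod uniqueDiffOn_univ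
  have h1 := hF.continuousOn_fderivWithin hud (by norm_num)
  have h2 : ContinuousOn (fun τ => fderivWithin ℝ F (Icc 0 T ×ˢ univ) (τ, x)
      (0, EuclideanSpace.single i 1)) (Icc 0 T) :=
    (h1.comp (by fun_prop) (fun τ hτ => ⟨hτ, mem_univ x⟩)).clm_apply continuousOn_const
  refine h2.congr fun τ hτ => ?_
  have h3 := (hF.differentiableOn (by norm_num) (τ, x) ⟨hτ, mem_univ x⟩).hasFDerivWithinAt
  have h4 := h3.comp x (hasFDerivAt_prodMk_left τ x).hasFDerivWithinAt
    (fun y (_ : y ∈ univ) => ⟨hτ, mem_univ y⟩)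
  have h5 := (hasFDerivWithinAt_univ.1 h4).fderiv
  simp only [Function.comp_def] at h5
  simp [partialDeriv, h5]

/-- The divergence constraint on the magnetic field is propagated by the induction equation. -/
theorem divergence_mag_eq_zero (hT : 0 < T) (hu : u.IsSmoothSolution s ε μ T)
    (ht : t ∈ Ioo 0 T) : divergence (u.mag t) x = 0 := by
  have hcont : ContinuousOn (fun τ => divergence (u.mag τ) x) (Icc 0 T) := by
    refine continuousOn_finsetSum _ fun i _ => ?_
    exact continuousOn_partialDeriv_slice (F := fun q => u.mag q.1 q.2 i) hT
      (contDiffOn_piLp 2 |>.1 hu.smooth_mag i) i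
  have hderiv : ∀ τ ∈ Ioo 0 T, HasDerivAt (fun τ => divergence (u.mag τ) x) 0 τ := by
    intro τ hτ
    have h1 : HasDerivAt (fun τ => divergence (u.mag τ) x)
        (∑ i, partialDeriv i (fun y => deriv (fun τ => u.mag τ y i) τ) x) τ :=
      HasDerivAt.fun_sum fun i _ =>
        hasDerivAt_partialDeriv (F := fun q => u.mag q.1 q.2 i) (hu.contDiffAt_mag_apply hτ i) i
    convert h1 using 1
    have h2 : divergence (tensorDivergence (u.inductionFlux τ)) x = 0 := by
      refine divergence_tensorDivergence_eq_zero (fun i j => ?_) fun y i j => ?_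
      · have hρ := (hu.smooth_rho.contDiffAt (slab_mem_nhds (x := x) hτ)).slice
        have hm := fun k => (hu.contDiffAt_mom_apply (x := x) hτ k).slice
        have hB := fun k => (hu.contDiffAt_mag_apply (x := x) hτ k).slice
        have hi := hρ.inv (hu.rho_pos τ (Ioo_subset_Icc_self hτ) x).ne'
        exact (hi.mul ((hm i).mul (hB j))).sub (hi.mul ((hB i).mul (hm j)))
      · simp only [inductionFlux, outer, Matrix.sub_apply, Matrix.smul_apply, Matrix.of_apply,
          smul_eq_mul]
        ring
    have h3 : ∀ i, partialDeriv i (fun y => deriv (fun τ => u.mag τ y i) τ) x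
        = -partialDeriv i (fun y => tensorDivergence (u.inductionFlux τ) y i) x := fun i => by
      simp_rw [(hu.hasDerivAt_mag_apply hτ i).deriv]
      simp [partialDeriv, fderiv_fun_neg]
    simp_rw [h3]
    rw [Finset.sum_neg_distrib]
    exact (neg_eq_zero.2 h2).symm
  obtain ⟨c, hc, hc'⟩ := exists_hasDerivAt_eq_slope (fun τ => divergence (u.mag τ) x) 0 ht.1
    (hcont.mono (Icc_subset_Icc_right ht.2.le))
    (fun τ hτ => hderiv τ ⟨hτ.1, hτ.2.trans ht.2⟩)
  rw [hu.initial_mag x, sub_zero, sub_zero, Pi.zero_apply, eq_comm, div_eq_zero_iff] at hc'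
  exact hc'.resolve_right ht.1.ne'

end IsSmoothSolution

end Flow

end MHD

/-! ### The touching function and the contradiction at a minimum -/

namespace MHD.Flow

variable {d : ℕ} {u : Flow d} {s : ℝ → ℝ → ℝ} {ε μ T t : ℝ} {x : Space d}

theorem sum_velocity_mul_self :
    ∑ k, u.velocity t x k * u.velocity t x k = ‖u.velocity t x‖ ^ 2 := by
  simp only [EuclideanSpace.norm_sq_eq, Real.norm_eq_abs, sq_abs]
  simp only [pow_two]

/-- The linearisation at a constant velocity `w` of the internal energy in terms of the conserved
variables. -/
theorem rho_mul_internalEnergy_le (hρ : 0 < u.rho t x) (w : Space d) :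
    u.rho t x * u.specificInternalEnergy μ t x
      ≤ u.energy t x - u.magneticEnergy μ t x - inner ℝ w (u.mom t x)
        + ‖w‖ ^ 2 / 2 * u.rho t x := by
  -- Expanded and divided by `2ρ`, this is the tangent-plane inequality for the convex function
  -- `|m|²/(2ρ)`.
  have h1 : 0 ≤ ‖u.mom t x - u.rho t x • w‖ ^ 2 := by positivity
  rw [norm_sub_sq_real, norm_smul, inner_smul_right, Real.norm_of_nonneg hρ.le,
    real_inner_comm] at h1
  have h2 : inner ℝ w (u.mom t x) - ‖w‖ ^ 2 / 2 * u.rho t x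
      ≤ ‖u.mom t x‖ ^ 2 / (2 * u.rho t x) := by
    rw [le_div_iff₀ (by positivity)]
    nlinarith
  rw [specificInternalEnergy, mul_inv_cancel_left₀ hρ.ne']
  linarith

/-- The affine function of the conserved variables that touches the entropy profile from above
at the state `(t₀, x₀)`. -/
noncomputable def touching (s : ℝ → ℝ → ℝ) (μ : ℝ) (u : Flow d) (t₀ : ℝ) (x₀ : Space d) (κ : ℝ)
    (t : ℝ) (x : Space d) : ℝ :=
  u.energy t x - u.magneticEnergy μ t x - inner ℝ (u.velocity t₀ x₀) (u.mom t x) + κ * u.rho t x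
    + u.pressureField s μ t₀ x₀

/-- The coefficient of the density in `touching`. -/
noncomputable def touchingCoeff (s : ℝ → ℝ → ℝ) (μ : ℝ) (u : Flow d) (t : ℝ) (x : Space d) : ℝ :=
  (∑ k, u.velocity t x k * u.velocity t x k) / 2 - u.specificInternalEnergy μ t x
    - (u.rho t x)⁻¹ * u.pressureField s μ t x

theorem touching_self (hρ : 0 < u.rho t x) :
    touching s μ u t x (touchingCoeff s μ u t x) t x = 0 := by
  have h1 : u.mom t x = u.rho t x • u.velocity t x := by
    rw [velocity, smul_inv_smul₀ hρ.ne']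
  have h2 := rho_mul_specificInternalEnergy (μ := μ) hρ
  have h3 : (u.rho t x)⁻¹ * u.rho t x = 1 := inv_mul_cancel₀ hρ.ne'
  rw [touching, touchingCoeff, h1, inner_smul_right, real_inner_self_eq_norm_sq,
    ← sum_velocity_mul_self]
  linear_combination -h2 - (u.pressureField s μ t x) * h3

/-- The tangent plane of `s` is affine in `(1/ρ, e)`. Multiplication by `ρ` turns `1/ρ` into a
constant and `e` into `ρ e`, which is then bounded by its linearization at the velocity of the
touching point. -/
theorem entropy_sub_le_touching (hs : IsAdmissibleEntropy s) (hρ : 0 < u.rho t x)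
    (he : 0 < u.specificInternalEnergy μ t x) {τ : ℝ} {y : Space d} (hρ' : 0 < u.rho τ y)
    (he' : 0 < u.specificInternalEnergy μ τ y) :
    u.rho τ y * (u.specificEntropy s μ τ y - u.specificEntropy s μ t x)
      ≤ entropyE s (u.rho t x) (u.specificInternalEnergy μ t x)
        * touching s μ u t x (touchingCoeff s μ u t x) τ y := by
  have h1 := hs.le_tangent hρ he hρ' he'
  have hb := hs.temperature_pos _ _ hρ he
  have h2 : u.specificEntropy s μ τ y - u.specificEntropy s μ t x
      ≤ entropyE s (u.rho t x) (u.specificInternalEnergy μ t x)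
        * (u.pressureField s μ t x * ((u.rho τ y)⁻¹ - (u.rho t x)⁻¹)
          + (u.specificInternalEnergy μ τ y - u.specificInternalEnergy μ t x)) := by
    simp only [specificEntropy, pressureField]; linarith
  refine (mul_le_mul_of_nonneg_left h2 hρ'.le).trans ?_
  rw [mul_left_comm]
  refine mul_le_mul_of_nonneg_left ?_ hb.le
  have h3 := rho_mul_internalEnergy_le (μ := μ) hρ' (u.velocity t x)
  have h4 : u.rho τ y * (u.rho τ y)⁻¹ = 1 := mul_inv_cancel₀ hρ'.ne'
  rw [touching, touchingCoeff, sum_velocity_mul_self]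
  linear_combination h3 + u.pressureField s μ t x * h4

namespace IsSmoothSolution

theorem contDiffAt_energy_sub_magneticEnergy (hu : u.IsSmoothSolution s ε μ T)
    (ht : t ∈ Ioo 0 T) : ContDiffAt ℝ 2
      (fun q : ℝ × Space d => u.energy q.1 q.2 - u.magneticEnergy μ q.1 q.2) (t, x) := by
  unfold magneticEnergy
  exact (hu.smooth_energy.contDiffAt (slab_mem_nhds ht)).sub
    (((hu.smooth_mag.contDiffAt (slab_mem_nhds ht)).norm_sq ℝ).div_const _)

theorem contDiffAt_touching (hu : u.IsSmoothSolution s ε μ T) (ht : t ∈ Ioo 0 T) (t₀ : ℝ)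
    (x₀ : Space d) (κ : ℝ) :
    ContDiffAt ℝ 2 (fun q : ℝ × Space d => touching s μ u t₀ x₀ κ q.1 q.2) (t, x) := by
  have h1 := hu.smooth_mom.contDiffAt (slab_mem_nhds (x := x) ht)
  have h2 := hu.smooth_rho.contDiffAt (slab_mem_nhds (x := x) ht)
  exact (((hu.contDiffAt_energy_sub_magneticEnergy ht).sub (contDiffAt_const.inner ℝ h1)).add
    (contDiffAt_const.mul h2)).add contDiffAt_const

theorem laplacian_touching (hu : u.IsSmoothSolution s ε μ T) (ht : t ∈ Ioo 0 T) (t₀ : ℝ)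
    (x₀ : Space d) (κ : ℝ) :
    Δ (touching s μ u t₀ x₀ κ t) x
      = Δ (fun y => u.energy t y - u.magneticEnergy μ t y) x
        - inner ℝ (u.velocity t₀ x₀) (Δ (u.mom t) x) + κ * Δ (u.rho t) x := by
  have h0 : ContDiffAt ℝ 2 (fun y => u.energy t y - u.magneticEnergy μ t y) x :=
    (hu.contDiffAt_energy_sub_magneticEnergy (x := x) ht).slice
  have h1 : ContDiffAt ℝ 2 (u.mom t) x :=
    (hu.smooth_mom.contDiffAt (slab_mem_nhds (x := x) ht)).slice
  have h2 : ContDiffAt ℝ 2 (u.rho t) x :=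
    (hu.smooth_rho.contDiffAt (slab_mem_nhds (x := x) ht)).slice
  have h3 : ContDiffAt ℝ 2 (innerSL ℝ (u.velocity t₀ x₀) ∘ u.mom t) x :=
    (innerSL ℝ (u.velocity t₀ x₀)).contDiff.contDiffAt.comp x h1
  have h4 : ContDiffAt ℝ 2 (κ • u.rho t) x := h2.const_smul κ
  have h5 : touching s μ u t₀ x₀ κ t
      = ((fun y => u.energy t y - u.magneticEnergy μ t y)
        - innerSL ℝ (u.velocity t₀ x₀) ∘ u.mom t + κ • u.rho t)
        + fun _ => u.pressureField s μ t₀ x₀ := rfl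
  have h6 : ContDiffAt ℝ 2 ((fun y => u.energy t y - u.magneticEnergy μ t y)
      - innerSL ℝ (u.velocity t₀ x₀) ∘ u.mom t) x := h0.sub h3
  have h7 : ContDiffAt ℝ 2 ((fun y => u.energy t y - u.magneticEnergy μ t y)
      - innerSL ℝ (u.velocity t₀ x₀) ∘ u.mom t + κ • u.rho t) x := h6.add h4
  rw [h5, h7.laplacian_add contDiffAt_const, h6.laplacian_add h4,
    h0.laplacian_sub h3, h1.laplacian_CLM_comp_left, InnerProductSpace.laplacian_smul κ h2,
    InnerProductSpace.laplacian_const]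
  simp

theorem partialDeriv_touching (hu : u.IsSmoothSolution s ε μ T) (ht : t ∈ Ioo 0 T) (t₀ : ℝ)
    (x₀ : Space d) (κ : ℝ) (i : Fin d) :
    partialDeriv i (touching s μ u t₀ x₀ κ t) x
      = partialDeriv i (fun y => u.energy t y - u.magneticEnergy μ t y) x
        - ∑ j, u.velocity t₀ x₀ j * partialDeriv i (fun y => u.mom t y j) x
        + κ * partialDeriv i (u.rho t) x := by
  have h0 := (hu.contDiffAt_energy_sub_magneticEnergy (x := x) ht).slice.differentiableAt
    (by norm_num)
  have h1 := fun j => (hu.contDiffAt_mom_apply (x := x) ht j).slice.differentiableAt (by norm_num)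
  have h2 : DifferentiableAt ℝ (u.rho t) x :=
    (hu.smooth_rho.contDiffAt (slab_mem_nhds (x := x) ht)).slice.differentiableAt (by norm_num)
  have h3 : touching s μ u t₀ x₀ κ t = fun y => (u.energy t y - u.magneticEnergy μ t y)
      - ∑ j, u.velocity t₀ x₀ j * u.mom t y j + κ * u.rho t y
      + u.pressureField s μ t₀ x₀ := by
    funext y
    simp only [touching, PiLp.inner_apply, RCLike.inner_apply, conj_trivial,
      mul_comm (u.mom t y _)]
  have h4 : DifferentiableAt ℝ (fun y => ∑ j, u.velocity t₀ x₀ j * u.mom t y j) x :=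
    DifferentiableAt.fun_sum fun j _ => (h1 j).const_mul _
  have h5 : partialDeriv i (fun y => ∑ j, u.velocity t₀ x₀ j * u.mom t y j) x
      = ∑ j, u.velocity t₀ x₀ j * partialDeriv i (fun y => u.mom t y j) x := by
    rw [partialDeriv_sum (F := fun j y => u.velocity t₀ x₀ j * u.mom t y j) Finset.univ i
      fun j _ => (h1 j).const_mul _]
    exact Finset.sum_congr rfl fun j _ => partialDeriv_const_mul i _ (h1 j)
  rw [h3, partialDeriv_add i ((h0.fun_sub h4).fun_add (h2.const_mul κ))
      (differentiableAt_const _), partialDeriv_add i (h0.fun_sub h4) (h2.const_mul κ),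
    partialDeriv_sub i h0 h4, h5, partialDeriv_const_mul i κ h2, partialDeriv_const, add_zero]

/-- The time derivative of `touching`, by the regularized system. -/
theorem hasDerivAt_touching (hu : u.IsSmoothSolution s ε μ T) (ht : t ∈ Ioo 0 T)
    (t₀ : ℝ) (x₀ : Space d) (κ : ℝ) :
    HasDerivAt (fun τ => touching s μ u t₀ x₀ κ τ x)
      (ε * Δ (touching s μ u t₀ x₀ κ t) x - (divergence (u.energyFlux s μ t) x
        - μ⁻¹ * ∑ j, u.mag t x j * tensorDivergence (u.inductionFlux t) x j
        - ∑ j, u.velocity t₀ x₀ j * tensorDivergence (u.momentumFlux s μ t) x j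
        + κ * divergence (u.mom t) x)) t := by
  have hE := (hu.smooth_energy.contDiffAt (slab_mem_nhds (x := x) ht)).differentiableAt_time
  have hm := (hu.smooth_mom.contDiffAt (slab_mem_nhds (x := x) ht)).differentiableAt_time
  have hr := (hu.smooth_rho.contDiffAt (slab_mem_nhds (x := x) ht)).differentiableAt_time
  have hme : HasDerivAt (fun τ => u.magneticEnergy μ τ x)
      (-(μ⁻¹ * ∑ j, u.mag t x j * tensorDivergence (u.inductionFlux t) x j)) t := by
    simp_rw [magneticEnergy_eq_sum]
    have h := (HasDerivAt.fun_sum (u := Finset.univ) fun j _ =>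
      (hu.hasDerivAt_mag_apply (x := x) ht j).fun_mul
        (hu.hasDerivAt_mag_apply (x := x) ht j)).const_mul (2 * μ)⁻¹
    refine h.congr_deriv ?_
    rw [Finset.mul_sum, Finset.mul_sum, ← Finset.sum_neg_distrib]
    refine Finset.sum_congr rfl fun j _ => ?_
    rw [mul_inv]
    ring
  have hm' : HasDerivAt (fun τ => inner ℝ (u.velocity t₀ x₀) (u.mom τ x))
      (inner ℝ (u.velocity t₀ x₀) (deriv (fun τ => u.mom τ x) t)) t :=
    (innerSL ℝ (u.velocity t₀ x₀)).hasFDerivAt.comp_hasDerivAt t hm.hasDerivAt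
  have hsum : ∑ j, u.velocity t₀ x₀ j * tensorDivergence (u.momentumFlux s μ t) x j
      = inner ℝ (u.velocity t₀ x₀) (tensorDivergence (u.momentumFlux s μ t) x) := by
    simp only [PiLp.inner_apply, RCLike.inner_apply, conj_trivial, mul_comm]
  have h := ((((hE.hasDerivAt.fun_sub hme).fun_sub hm').fun_add
    (hr.hasDerivAt.const_mul κ))).add_const (u.pressureField s μ t₀ x₀)
  refine h.congr_deriv ?_
  have e1 := hu.totalEnergy t ht x
  have e2 := eq_sub_of_add_eq (hu.momentum t ht x)
  have e3 := hu.mass t ht x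
  rw [hu.laplacian_touching ht, e2, inner_sub_right, inner_smul_right, hsum]
  linear_combination e1 + κ * e3

/-- The specific entropy cannot attain, at an interior time, a minimum over the past that
decreases at a positive rate. -/
theorem not_touching_from_below (hs : IsAdmissibleEntropy s) (hε : 0 < ε) (hμ : 0 < μ)
    (hT : 0 < T) (hu : u.IsSmoothSolution s ε μ T) (ht : t ∈ Ioo 0 T) {η : ℝ} (hη : 0 < η)
    (hmin : ∀ τ ∈ Icc 0 t, ∀ y,
      u.specificEntropy s μ t x + η * t ≤ u.specificEntropy s μ τ y + η * τ) : False := by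
  have hmem : ∀ τ ∈ Icc 0 t, τ ∈ Icc 0 T := fun τ hτ => ⟨hτ.1, hτ.2.trans ht.2.le⟩
  have htt : t ∈ Icc 0 t := ⟨ht.1.le, le_rfl⟩
  have hρ := hu.rho_pos t (hmem t htt)
  have he := hu.internalEnergy_pos t (hmem t htt)
  set b := entropyE s (u.rho t x) (u.specificInternalEnergy μ t x) with hb_def
  have hb : 0 < b := hs.temperature_pos _ _ (hρ x) (he x)
  set κ := touchingCoeff s μ u t x with hκ
  set H := touching s μ u t x κ with hH
  have hH0 : H t x = 0 := touching_self (hρ x)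
  have hle : ∀ τ ∈ Icc 0 t, ∀ y, u.rho τ y * (η * (t - τ)) ≤ b * H τ y := fun τ hτ y => by
    have h1 := entropy_sub_le_touching hs (hρ x) (he x) (hu.rho_pos τ (hmem τ hτ) y)
      (hu.internalEnergy_pos τ (hmem τ hτ) y)
    refine le_trans (mul_le_mul_of_nonneg_left ?_ (hu.rho_pos τ (hmem τ hτ) y).le) h1
    linarith [hmin τ hτ y]
  have hspace : IsLocalMin (H t) x := Eventually.of_forall fun y => by
    have := hle t htt y
    rw [sub_self, mul_zero, mul_zero] at this
    rw [hH0]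
    exact nonneg_of_mul_nonneg_right this hb
  have hlap : 0 ≤ Δ (H t) x := hspace.laplacian_nonneg (hu.contDiffAt_touching ht t x κ).slice
  have hgrad : ∀ i, partialDeriv i (H t) x = 0 := fun i => by
    rw [partialDeriv, hspace.fderiv_eq_zero]; rfl
  have hflux := entropy_flux_eq_zero (s := s) hμ hρ
    ((hu.smooth_rho.contDiffAt (slab_mem_nhds (x := x) ht)).slice.differentiableAt (by norm_num))
    (fun j => (hu.contDiffAt_mom_apply (x := x) ht j).slice.differentiableAt (by norm_num))
    ((hu.smooth_energy.contDiffAt (slab_mem_nhds (x := x) ht)).slice.differentiableAt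
      (by norm_num))
    (fun j => (hu.contDiffAt_mag_apply (x := x) ht j).slice.differentiableAt (by norm_num))
    (hu.differentiableAt_pressureField hs ht) (hu.divergence_mag_eq_zero hT ht) hκ
    (fun i => by rw [← hu.partialDeriv_touching ht]; exact hgrad i)
  have hdt := hu.hasDerivAt_touching ht t x κ (x := x)
  rw [hflux, sub_zero] at hdt
  have hrt := (hu.smooth_rho.contDiffAt
    (slab_mem_nhds (x := x) ht)).differentiableAt_time.hasDerivAt
  -- The function `b H - ρ η (t - τ)` of `τ` is nonnegative in the past and zero at `τ = t`. Its
  -- derivative there is `b ε ΔH + ρ η`, the term with `∂ₜρ` dropping out because its factor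
  -- vanishes.
  have hψ := (hdt.const_mul b).fun_sub
    (hrt.fun_mul (((hasDerivAt_id t).const_sub t).const_mul η))
  have hev : ∀ᶠ τ in 𝓝[<] t, τ ∈ Icc 0 t := by
    filter_upwards [Ioo_mem_nhdsLT ht.1] with τ hτ using ⟨hτ.1.le, hτ.2.le⟩
  have hnonpos := hψ.nonpos_of_forall_left_le <| by
    filter_upwards [hev] with τ hτ
    have := hle τ hτ x
    change b * H t x - _ ≤ b * H τ x - _
    simp only [id, hH0, sub_self, mul_zero]
    linarith
  have h1 : 0 ≤ b * (ε * Δ (H t) x) := by positivity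
  have h2 : 0 < u.rho t x * η := mul_pos (hρ x) hη
  simp only [id, sub_self, mul_zero, zero_add] at hnonpos
  linarith

end IsSmoothSolution

end MHD.Flow

/-! ### Behaviour at infinity and existence of a touching point -/

namespace MHD.Flow

variable {d : ℕ} {u : Flow d} {s : ℝ → ℝ → ℝ} {ε μ T t : ℝ} {x : Space d}

theorem IsSmoothSolution.continuousOn_specificEntropy (hs : IsAdmissibleEntropy s)
    (hu : u.IsSmoothSolution s ε μ T) :
    ContinuousOn (fun q : ℝ × Space d => u.specificEntropy s μ q.1 q.2) (Icc 0 T ×ˢ univ) :=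
  hs.smooth.continuousOn.comp
    (f := fun q : ℝ × Space d => (u.rho q.1 q.2, u.specificInternalEnergy μ q.1 q.2))
    (hu.smooth_rho.continuousOn.prodMk hu.contDiffOn_specificInternalEnergy.continuousOn)
    fun q hq => ⟨hu.rho_pos q.1 hq.1 q.2, hu.internalEnergy_pos q.1 hq.1 q.2⟩

/-- The specific entropy converges at spatial infinity, uniformly in time. -/
theorem ConvergesToConstantState.specificEntropy (hs : IsAdmissibleEntropy s)
    (hconv : u.ConvergesToConstantState μ T) :
    ∃ sinf : ℝ, TendstoUniformlyOn (fun x t => u.specificEntropy s μ t x) (fun _ => sinf)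
      (cocompact (Space d)) (Icc 0 T) := by
  obtain ⟨ρ, e, hρ, he, h1, h2⟩ := hconv
  refine ⟨s ρ e, ?_⟩
  rw [Metric.tendstoUniformlyOn_iff] at h1 h2 ⊢
  intro δ hδ
  obtain ⟨r, hr, hcont⟩ := Metric.continuousAt_iff.1 (hs.contDiffAt hρ he).continuousAt δ hδ
  filter_upwards [h1 r hr, h2 r hr] with y h3 h4 τ hτ
  rw [dist_comm]
  refine hcont (x := (u.rho τ y, u.specificInternalEnergy μ τ y)) ?_
  rw [dist_comm, Prod.dist_eq]
  exact max_lt (h3 τ hτ) (h4 τ hτ)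

/-- Below the initial infimum, the specific entropy is bounded from below away from a compact
set. -/
theorem ConvergesToConstantState.eventually_lt (hs : IsAdmissibleEntropy s) (hT : 0 < T)
    (hconv : u.ConvergesToConstantState μ T) {c c' : ℝ}
    (hc : ∀ y, c ≤ u.specificEntropy s μ 0 y) (hc' : c' < c) :
    ∀ᶠ y in cocompact (Space d), ∀ τ ∈ Icc 0 T, c' < u.specificEntropy s μ τ y := by
  -- For `d = 0` space is compact and there is nothing at infinity; otherwise limits along the
  -- filter preserve inequalities.
  rcases (cocompact (Space d)).eq_or_neBot with hbot | hne
  · rw [hbot]; exact eventually_bot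
  obtain ⟨sinf, h⟩ := hconv.specificEntropy hs
  have h0 : Tendsto (fun y => u.specificEntropy s μ 0 y) (cocompact (Space d)) (𝓝 sinf) :=
    h.tendsto_at (left_mem_Icc.2 hT.le)
  have hle : c ≤ sinf := ge_of_tendsto' h0 hc
  filter_upwards [Metric.tendstoUniformlyOn_iff.1 h (sinf - c') (by linarith)] with y hy τ hτ
  have := hy τ hτ
  rw [Real.dist_eq] at this
  linarith [le_abs_self (sinf - u.specificEntropy s μ τ y)]

theorem IsSmoothSolution.le_specificEntropy_of_lt (hs : IsAdmissibleEntropy s) (hε : 0 < ε)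
    (hμ : 0 < μ) (hT : 0 < T) (hu : u.IsSmoothSolution s ε μ T)
    (hconv : u.ConvergesToConstantState μ T) {c c' : ℝ}
    (hc : ∀ y, c ≤ u.specificEntropy s μ 0 y) (hc' : c' < c) (ht : t ∈ Ioo 0 T) (x : Space d) :
    c' ≤ u.specificEntropy s μ t x := by
  by_contra! hlt
  obtain ⟨K, hK, hKc⟩ := mem_cocompact.1 (hconv.eventually_lt hs hT hc hc')
  -- The slope for which the tilted entropy at `(t, x)` is exactly `c'`, a value below all initial
  -- ones and below all those outside `K`.
  set η := (c' - u.specificEntropy s μ t x) / t with hη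
  have hηpos : 0 < η := div_pos (sub_pos.2 hlt) ht.1
  have hval : u.specificEntropy s μ t x + η * t = c' := by
    rw [hη, div_mul_cancel₀ _ ht.1.ne']; ring
  -- Adding `x` to `K` ensures that the minimum over the compact set is at most `c'`.
  have hsub : Icc 0 t ×ˢ insert x K ⊆ Icc 0 T ×ˢ (univ : Set (Space d)) :=
    prod_mono (Icc_subset_Icc_right ht.2.le) (subset_univ _)
  have hcomp : IsCompact (Icc 0 t ×ˢ insert x K) := isCompact_Icc.prod (hK.insert x)
  have htt : t ∈ Icc 0 t := right_mem_Icc.2 ht.1.le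
  obtain ⟨⟨t₀, x₀⟩, ⟨ht₀, _⟩, hmin⟩ := hcomp.exists_isMinOn ⟨(t, x), htt, mem_insert x K⟩
    (f := fun q => u.specificEntropy s μ q.1 q.2 + η * q.1)
    (((hu.continuousOn_specificEntropy hs).mono hsub).add (by fun_prop))
  have hle : u.specificEntropy s μ t₀ x₀ + η * t₀ ≤ c' := by
    rw [← hval]; exact isMinOn_iff.1 hmin (t, x) ⟨htt, mem_insert x K⟩
  have ht₀pos : 0 < t₀ := by
    refine lt_of_le_of_ne ht₀.1 fun h => ?_
    rw [← h, mul_zero, add_zero] at hle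
    linarith [hc x₀]
  refine hu.not_touching_from_below hs hε hμ hT (t := t₀) (x := x₀)
    ⟨ht₀pos, ht₀.2.trans_lt ht.2⟩ hηpos fun τ hτ y => ?_
  have hτt : τ ∈ Icc 0 t := ⟨hτ.1, hτ.2.trans ht₀.2⟩
  by_cases hy : y ∈ insert x K
  · exact isMinOn_iff.1 hmin (τ, y) ⟨hτt, hy⟩
  · have h1 : c' < u.specificEntropy s μ τ y :=
      hKc (fun h => hy (mem_insert_of_mem x h)) τ ⟨hτ.1, hτt.2.trans ht.2.le⟩
    have h2 : 0 ≤ η * τ := mul_nonneg hηpos.le hτ.1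
    linarith

theorem IsSmoothSolution.le_specificEntropy (hs : IsAdmissibleEntropy s) (hε : 0 < ε)
    (hμ : 0 < μ) (hT : 0 < T) (hu : u.IsSmoothSolution s ε μ T)
    (hconv : u.ConvergesToConstantState μ T) {c : ℝ}
    (hc : ∀ y, c ≤ u.specificEntropy s μ 0 y) (ht : t ∈ Icc 0 T) (x : Space d) :
    c ≤ u.specificEntropy s μ t x := by
  have hint : ∀ τ ∈ Ioo 0 T, c ≤ u.specificEntropy s μ τ x := fun τ hτ =>
    le_of_forall_lt fun c' hc' => by
      -- The intermediate value supplies the strict inequality required here.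
      obtain ⟨c'', h1, h2⟩ := exists_between hc'
      exact h1.trans_le (hu.le_specificEntropy_of_lt hs hε hμ hT hconv hc h2 hτ x)
  have hcont : ContinuousOn (fun τ => u.specificEntropy s μ τ x) (Icc 0 T) :=
    (hu.continuousOn_specificEntropy hs).comp (f := fun τ => (τ, x)) (by fun_prop)
      fun τ hτ => ⟨hτ, mem_univ x⟩
  -- The endpoints `0` and `T` are covered by continuity in time.
  rw [← closure_Ioo hT.ne] at hcont ht
  exact le_on_closure (f := fun _ => c) hint continuousOn_const hcont ht

end MHD.Flow

/-- Minimum principle of the specific entropy. The infima are taken in the extended reals. -/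
theorem mainTheorem5 (d : ℕ) (s : ℝ → ℝ → ℝ) (hs : MHD.IsAdmissibleEntropy s)
    (ε μ T : ℝ) (hε : 0 < ε) (hμ : 0 < μ) (hT : 0 < T)
    (u : MHD.Flow d) (hu : u.IsSmoothSolution s ε μ T)
    (hconv : u.ConvergesToConstantState μ T) :
    ∀ t ∈ Set.Icc 0 T,
      (⨅ x : MHD.Space d, ((u.specificEntropy s μ 0 x : ℝ) : EReal)) ≤
        ⨅ x : MHD.Space d, ((u.specificEntropy s μ t x : ℝ) : EReal) := by
  intro t ht
  -- Testing against real `c > s(t, x)` avoids any assumption that the initial infimum is finite: a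
  -- `c` below that infimum would be a real lower bound for the initial entropy, hence for `s(t,
  -- x)`.
  refine le_iInf fun x => EReal.le_of_forall_lt_iff_le.1 fun c hc => ?_
  by_contra! hlt
  have hc0 : ∀ y, c ≤ u.specificEntropy s μ 0 y := fun y =>
    EReal.coe_le_coe_iff.1 (hlt.le.trans (iInf_le _ y))
  exact (EReal.coe_lt_coe_iff.1 hc).not_ge (hu.le_specificEntropy hs hε hμ hT hconv hc0 ht x)
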